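/- Let $\mathcal O$ be the ring of germs at $0\in\mathbb C$ of holomorphic functions and let $\varepsilon=t\frac{d}{dt}$ be the Euler derivation. A Fuchsian operator of order $n\ge 0$ is a differential operator $L=\sum_{i=0}^n r_i(t)\,\varepsilon^{i}$ with $r_i\in\mathcal O$ and $r_n(0)\neq 0$. Collecting powers of $t$, it expands as $L=\sum_{k\ge 0}t^k p_k(\varepsilon)$ with $p_k\in\mathbb C[\varepsilon]$, $\deg p_k\le n=\deg p_0$; the polynomial $p_0=\mathcal E(L)$ is called the Euler part of $L$. Two Fuchsian operators $L,M$ of the same order are called $\mathcal F$-equivalent if there exist Fuchsian operators $H,K$ (of any order, with convergent coefficients) such that $MH=KL$ and $\gcd(\mathcal E(H),\mathcal E(L))=1$. For a polynomial $p\in\mathbb C[\varepsilon]$ write $p^{[j]}(\varepsilon)=p(\varepsilon+j)$. Then every Fuchsian operator $L=p_0(\varepsilon)+t\,p_1(\varepsilon)+t^2p_2(\varepsilon)+\cdots$ is $\mathcal F$-equivalent to a Fuchsian operator $M$ of the form $$M=p_0(\varepsilon)+\sum_{j=1}^{N}t^j q_j(\varepsilon),\qquad q_j\in\mathbb C[\varepsilon],\quad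 \deg q_j\le \nu_j-1,\quad \nu_j=\deg\gcd\bigl(p_0,p_0^{[j]}\bigr),$$ for some finite $N$ (where $\deg q_j\le -1$ means $q_j=0$). In particular, $q_j=0$ for every nonresonant order $j$, that is, for every $j\ge1$ such that no two roots of $p_0$ differ by $j$. -/

import Mathlib

open Filter Topology Polynomial

noncomputable section

namespace FuchsianOps

/-- The ring `𝒪(ℂ,0)` of germs at `0` of holomorphic functions, as a subring of the ring of all
germs at `0` of functions `ℂ → ℂ`. -/
def holoSubring : Subring (Germ (𝓝 (0 : ℂ)) ℂ) where
  carrier := {φ | ∃ f : ℂ → ℂ, AnalyticAt ℂ f 0 ∧ (f : Germ (𝓝 (0 : ℂ)) ℂ) = φ}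
  mul_mem' := by
    rintro _ _ ⟨f, hf, rfl⟩ ⟨g, hg, rfl⟩
    exact ⟨f * g, hf.mul hg, rfl⟩
  one_mem' := ⟨1, analyticAt_const, rfl⟩
  add_mem' := by
    rintro _ _ ⟨f, hf, rfl⟩ ⟨g, hg, rfl⟩
    exact ⟨f + g, hf.add hg, rfl⟩
  zero_mem' := ⟨0, analyticAt_const, rfl⟩
  neg_mem' := by
    rintro _ ⟨f, hf, rfl⟩
    exact ⟨-f, hf.neg, rfl⟩

/-- Germs at `0` of holomorphic functions of one complex variable. -/
abbrev HoloGerm : Type := holoSubring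

/-- The germ of a function that is analytic at `0`. -/
def germOf (f : ℂ → ℂ) (hf : AnalyticAt ℂ f 0) : HoloGerm := ⟨(f : Germ (𝓝 (0 : ℂ)) ℂ), f, hf, rfl⟩

theorem exists_germOf (φ : HoloGerm) : ∃ (f : ℂ → ℂ) (hf : AnalyticAt ℂ f 0), germOf f hf = φ := by
  obtain ⟨_, f, hf, rfl⟩ := φ
  exact ⟨f, hf, rfl⟩

theorem germOf_eq_iff {f g : ℂ → ℂ} (hf : AnalyticAt ℂ f 0) (hg : AnalyticAt ℂ g 0) :
    germOf f hf = germOf g hg ↔ f =ᶠ[𝓝 0] g := by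
  exact Subtype.ext_iff.trans Germ.coe_eq

/-- The germs of constant functions make `HoloGerm` a `ℂ`-algebra. -/
def constHom : ℂ →+* HoloGerm where
  toFun c := germOf (fun _ => c) analyticAt_const
  map_one' := rfl
  map_mul' _ _ := rfl
  map_zero' := rfl
  map_add' _ _ := rfl

instance instAlgebraHoloGerm : Algebra ℂ HoloGerm := constHom.toAlgebra

/-- The germ of the coordinate function `t`. -/
def tGerm : HoloGerm := germOf (fun z => z) analyticAt_id

/-- The derivative `d/dt` of a germ. -/
def derivGerm (φ : HoloGerm) : HoloGerm :=
  ⟨Germ.map' (lc := 𝓝 (0 : ℂ)) deriv (fun _ _ h => EventuallyEq.deriv h) φ.1, by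
    obtain ⟨_, f, hf, rfl⟩ := φ
    exact ⟨deriv f, hf.deriv, rfl⟩⟩

theorem derivGerm_germOf {f : ℂ → ℂ} (hf : AnalyticAt ℂ f 0) :
    derivGerm (germOf f hf) = germOf (deriv f) hf.deriv := rfl

/-- The `k`-th Taylor coefficient at `0` of a germ; for `k = 0` this is its value at `0`. -/
def taylorCoeff (k : ℕ) (φ : HoloGerm) : ℂ :=
  Germ.liftOn φ.1 (fun f => iteratedDeriv k f 0 / (k.factorial : ℂ))
    (fun _ _ h => by simp only [EventuallyEq.iteratedDeriv_eq k h])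

theorem taylorCoeff_germOf (k : ℕ) {f : ℂ → ℂ} (hf : AnalyticAt ℂ f 0) :
    taylorCoeff k (germOf f hf) = iteratedDeriv k f 0 / (k.factorial : ℂ) := rfl

/-- The Euler derivation `ε = t d/dt`, as a `ℂ`-linear operator on germs. -/
def euler : Module.End ℂ HoloGerm where
  toFun φ := tGerm * derivGerm φ
  map_add' φ ψ := by
    obtain ⟨f, hf, rfl⟩ := exists_germOf φ
    obtain ⟨g, hg, rfl⟩ := exists_germOf ψ
    rw [← mul_add]
    congr 1
    refine (germOf_eq_iff (hf.add hg).deriv (hf.deriv.add hg.deriv)).2 ?_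
    filter_upwards [hf.eventually_analyticAt, hg.eventually_analyticAt] with z hz hz'
    exact deriv_add hz.differentiableAt hz'.differentiableAt
  map_smul' c φ := by
    obtain ⟨f, hf, rfl⟩ := exists_germOf φ
    have key : derivGerm (c • germOf f hf) = c • derivGerm (germOf f hf) := by
      refine (germOf_eq_iff (analyticAt_const.mul hf).deriv
        ((analyticAt_const (v := c)).mul hf.deriv)).2 ?_
      filter_upwards [hf.eventually_analyticAt] with z hz
      exact deriv_const_mul c hz.differentiableAt
    rw [key, RingHom.id_apply, mul_smul_comm]

theorem euler_germOf {f : ℂ → ℂ} (hf : AnalyticAt ℂ f 0) :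
    euler (germOf f hf) = germOf (fun z => z * deriv f z) (analyticAt_id.mul hf.deriv) := rfl

/-- A differential operator `∑ r_i ε^i` with holomorphic coefficients `r_i` written to the left of
the powers of the Euler derivation is recorded by the polynomial `∑ r_i X^i`. Its order is the
degree of this polynomial. (The composition of operators is *not* the product of polynomials, see
`toOp`.) -/
abbrev DiffOp : Type := HoloGerm[X]

/-- The operator `u ↦ ∑ r_i ε^i u` on germs defined by the coefficients `r_i`. The composition of
differential operators is the product in `Module.End ℂ HoloGerm`. -/
def toOp (P : DiffOp) : Module.End ℂ HoloGerm :=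
  P.eval₂ (Algebra.lmul ℂ HoloGerm : HoloGerm →+* Module.End ℂ HoloGerm) euler

theorem toOp_apply (P : DiffOp) (u : HoloGerm) :
    toOp P u = ∑ i ∈ Finset.range (P.natDegree + 1), P.coeff i * (euler ^ i) u := by
  rw [toOp, eval₂_eq_sum_range, LinearMap.sum_apply]
  rfl

theorem eq_zero_or_eq_zero_of_mul {φ ψ : HoloGerm} (h : φ * ψ = 0) : φ = 0 ∨ ψ = 0 := by
  obtain ⟨f, hf, rfl⟩ := exists_germOf φ
  obtain ⟨g, hg, rfl⟩ := exists_germOf ψ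
  have h0 : ∀ᶠ z in 𝓝 (0 : ℂ), f z * g z = 0 :=
    (germOf_eq_iff (hf.mul hg) (analyticAt_const (v := 0))).1 h
  rcases hf.eventually_eq_zero_or_eventually_ne_zero with h1 | h1
  · exact Or.inl ((germOf_eq_iff hf (analyticAt_const (v := 0))).2 h1)
  rcases hg.eventually_eq_zero_or_eventually_ne_zero with h2 | h2
  · exact Or.inr ((germOf_eq_iff hg (analyticAt_const (v := 0))).2 h2)
  obtain ⟨z, hz, hz1, hz2⟩ := ((h0.filter_mono nhdsWithin_le_nhds).and (h1.and h2)).exists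
  exact absurd hz (mul_ne_zero hz1 hz2)

instance instNontrivialHoloGerm : Nontrivial HoloGerm :=
  Subring.instNontrivialSubtypeMem holoSubring

instance instIsDomainHoloGerm : IsDomain HoloGerm :=
  have : NoZeroDivisors HoloGerm := ⟨fun h => eq_zero_or_eq_zero_of_mul h⟩
  NoZeroDivisors.to_isDomain HoloGerm

theorem tGerm_pow (m : ℕ) :
    tGerm ^ m = germOf (fun z => z ^ m) (analyticAt_id.pow m) := rfl

theorem euler_tGerm_pow (m : ℕ) : euler (tGerm ^ m) = (m : HoloGerm) * tGerm ^ m := by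
  have h : (m : HoloGerm) * tGerm ^ m
      = germOf (fun z => (m : ℂ) * z ^ m) (analyticAt_const.mul (analyticAt_id.pow m)) := rfl
  rw [h, tGerm_pow, euler_germOf]
  refine (germOf_eq_iff _ _).2 (Eventually.of_forall fun z => ?_)
  cases m with
  | zero => simp
  | succ m =>
    have h2 : deriv (fun z : ℂ => z ^ (m + 1)) z = ((m + 1 : ℕ) : ℂ) * z ^ m := by simp
    simp only [h2]
    ring

theorem euler_pow_tGerm_pow (i m : ℕ) :
    (euler ^ i) (tGerm ^ m) = (m : HoloGerm) ^ i * tGerm ^ m := by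
  induction i with
  | zero => simp
  | succ i ih =>
    have h : (m : HoloGerm) ^ i * tGerm ^ m = (m ^ i : ℕ) • tGerm ^ m := by simp
    rw [pow_succ', Module.End.mul_apply, ih, h, map_nsmul, euler_tGerm_pow]
    simp [pow_succ, mul_assoc]

/-- A differential operator determines its coefficients `r_i`. -/
theorem toOp_injective : Function.Injective toOp := by
  intro P Q h
  have : CharZero HoloGerm := charZero_of_injective_algebraMap (FaithfulSMul.algebraMap_injective ℂ HoloGerm)
  rw [← sub_eq_zero]
  refine eq_zero_of_infinite_isRoot _ ((Set.infinite_range_of_injective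
    (Nat.cast_injective (R := HoloGerm))).mono ?_)
  rintro _ ⟨m, rfl⟩
  have hP : ∀ R : DiffOp, toOp R (tGerm ^ m) = R.eval (m : HoloGerm) * tGerm ^ m := by
    intro R
    rw [toOp_apply, eval_eq_sum_range, Finset.sum_mul]
    exact Finset.sum_congr rfl fun i _ => by rw [euler_pow_tGerm_pow, mul_assoc]
  have ht : tGerm ^ m ≠ 0 := by
    refine pow_ne_zero _ fun h0 => ?_
    have h1 := (congrArg (fun φ => taylorCoeff 1 φ) h0)
    have h2 : taylorCoeff 1 (0 : HoloGerm) = 0 := by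
      change iteratedDeriv 1 (0 : ℂ → ℂ) 0 / _ = 0
      simp [iteratedDeriv_one]
    have h3 : taylorCoeff 1 tGerm = 1 := by
      rw [tGerm, taylorCoeff_germOf]
      simp
    simp [h2, h3] at h1
  have h4 : P.eval (m : HoloGerm) * tGerm ^ m = Q.eval (m : HoloGerm) * tGerm ^ m := by
    rw [← hP, ← hP, h]
  simp [IsRoot, mul_right_cancel₀ ht h4]

/-- The coefficient `p_k ∈ ℂ[ε]` of the noncommutative Taylor expansion
`∑ r_i(t) ε^i = ∑ t^k p_k(ε)`. -/
def taylorPart (k : ℕ) (P : DiffOp) : ℂ[X] :=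
  ∑ i ∈ Finset.range (P.natDegree + 1), monomial i (taylorCoeff k (P.coeff i))

/-- The Euler part `p_0` of `∑ t^k p_k(ε)`. -/
def eulerPart (P : DiffOp) : ℂ[X] := taylorPart 0 P

/-- An operator `∑_{i ≤ n} r_i ε^i` of order `n` with holomorphic coefficients is Fuchsian if its
leading coefficient `r_n` does not vanish at `0`. -/
def IsFuchsian (P : DiffOp) : Prop := taylorCoeff 0 P.leadingCoeff ≠ 0

/-- Two Fuchsian operators `L`, `M` of the same order are Fuchsian equivalent if `M H = K L` for
two Fuchsian operators `H`, `K` (of any order) such that the Euler parts of `H` and `L` are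
coprime. -/
def FEquiv (L M : DiffOp) : Prop :=
  L.natDegree = M.natDegree ∧
    ∃ H K : DiffOp, IsFuchsian H ∧ IsFuchsian K ∧
      toOp M * toOp H = toOp K * toOp L ∧ IsCoprime (eulerPart H) (eulerPart L)

/-- The operator `q(ε)` with constant coefficients. -/
def eulerOp (q : ℂ[X]) : DiffOp := q.map (algebraMap ℂ HoloGerm)

/-- The operator `t^j q(ε)`. -/
def tPowOp (j : ℕ) (q : ℂ[X]) : DiffOp := C (tGerm ^ j) * eulerOp q

theorem toOp_eulerOp (q : ℂ[X]) : toOp (eulerOp q) = aeval euler q := by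
  rw [toOp, eulerOp, eval₂_map, aeval_def]
  congr 1

theorem toOp_tPowOp (j : ℕ) (q : ℂ[X]) :
    toOp (tPowOp j q) = LinearMap.mulLeft ℂ (tGerm ^ j) * aeval euler q := by
  rw [← toOp_eulerOp, toOp, toOp, tPowOp, ← smul_eq_C_mul, eval₂_smul]
  rfl

/-- The shift `w^{[j]}(ε) = w(ε + j)` of a polynomial. -/
def shift (j : ℕ) (w : ℂ[X]) : ℂ[X] := w.comp (X + C (j : ℂ))

/-- `ν_j = deg gcd(p, p^{[j]})`. -/
def nu (p : ℂ[X]) (j : ℕ) : ℕ := (EuclideanDomain.gcd p (shift j p)).natDegree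

/-- The number `j` is a nonresonant order for `p` if no two roots of `p` differ by `j`. -/
def IsNonresonantOrder (p : ℂ[X]) (j : ℕ) : Prop :=
  ∀ a b : ℂ, p.IsRoot a → p.IsRoot b → a - b ≠ (j : ℂ)

end FuchsianOps

end

/-! Since `p(ε) t^b = t^b p^{[b]}(ε)`, expanding `H`, `K`, `M` with parts `h_k`, `g_k`, `q_k` turns
`M H = K L` into one polynomial equation for each power of `t`. In order `j` it reads `p_0^{[j]} h_j
+ q_j h_0 = g_j p_0 + F_j`, where `F_j` involves only earlier terms. Put `d = gcd(p_0, p_0^{[j]})`.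
Modulo `p_0`, the multiples of `p_0^{[j]}` are the multiples of `d`. As `h_0` is coprime to `p_0`,
it is invertible modulo `d`, so a `q_j` of degree below `deg d = ν_j` absorbs the obstruction
(`exists_homological_solution`). The polynomial `p_0` has finitely many roots, so only finitely many
orders are resonant, and `M` is polynomial in `t`.

What remains is convergence of `H` and `K`. Multiplication by `p_0^{[j]}` modulo `p_0` is `lc(p_0)
j^n + O(j^{n-1})`, so solving for `h_j` gains a factor `j^{-n}` (`exists_pow_mul_polyNorm_le`). This
offsets the factor `(1+b)^n` lost in `q_{j-b}^{[b]} h_b`. With `(1+j)^n ‖h_j‖ + ‖g_j‖` as unknown,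
the recursion becomes a convolution inequality with geometrically bounded kernel, and
`GeomBounded.of_le_convolution` gives geometric growth.

The choice `h_0 = g_0 = X p_0 + 1` is coprime to `p_0` and has degree `n + 1`, which bounds the
degrees of all `h_j` and `g_j`; hence `H` and `K` are Fuchsian. -/

namespace FuchsianOps

/-! ### Geometrically bounded sequences -/

/-- A real sequence bounded above by a geometric progression. -/
def GeomBounded (a : ℕ → ℝ) : Prop := ∃ A S : ℝ, 0 ≤ A ∧ 1 ≤ S ∧ ∀ k, a k ≤ A * S ^ k

namespace GeomBounded

theorem mono {a b : ℕ → ℝ} (hb : GeomBounded b) (h : ∀ k, a k ≤ b k) : GeomBounded a := by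
  obtain ⟨A, S, hA, hS, hk⟩ := hb
  exact ⟨A, S, hA, hS, fun k => (h k).trans (hk k)⟩

theorem add {a b : ℕ → ℝ} (ha : GeomBounded a) (hb : GeomBounded b) :
    GeomBounded (fun k => a k + b k) := by
  obtain ⟨A, S, hA, hS, ha⟩ := ha
  obtain ⟨B, T, hB, hT, hb⟩ := hb
  refine ⟨A + B, max S T, by positivity, le_max_of_le_left hS, fun k => ?_⟩
  rw [add_mul]
  refine add_le_add ((ha k).trans ?_) ((hb k).trans ?_)
  · gcongr
    exact le_max_left _ _
  · gcongr
    exact le_max_right _ _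

theorem mul {a b : ℕ → ℝ} (ha : GeomBounded a) (hb : GeomBounded b) (hb0 : ∀ k, 0 ≤ b k) :
    GeomBounded (fun k => a k * b k) := by
  obtain ⟨A, S, hA, hS, ha⟩ := ha
  obtain ⟨B, T, hB, hT, hb⟩ := hb
  refine ⟨A * B, S * T, by positivity, one_le_mul_of_one_le_of_one_le hS hT, fun k => ?_⟩
  calc a k * b k ≤ (A * S ^ k) * (B * T ^ k) := by
        gcongr
        · exact hb0 k
        · exact ha k
        · exact hb k
    _ = _ := by rw [mul_pow]; ring

theorem const (c : ℝ) : GeomBounded (fun _ => c) :=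
  ⟨|c|, 1, abs_nonneg c, le_rfl, fun k => by simpa using le_abs_self c⟩

theorem sum {ι : Type*} (s : Finset ι) {a : ι → ℕ → ℝ} (h : ∀ i ∈ s, GeomBounded (a i)) :
    GeomBounded (fun k => ∑ i ∈ s, a i k) := by
  classical
  induction s using Finset.induction_on with
  | empty => simpa using const 0
  | insert i s hi ih =>
    simp only [Finset.sum_insert hi]
    exact (h i (by simp)).add (ih fun j hj => h j (by simp [hj]))

theorem one_add_natCast_pow (m : ℕ) : GeomBounded (fun k => (1 + (k : ℝ)) ^ m) := by
  refine ⟨1, 2 ^ m, zero_le_one, one_le_pow₀ one_le_two, fun k => ?_⟩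
  rw [one_mul, ← pow_mul, mul_comm, pow_mul]
  refine pow_le_pow_left₀ (by positivity) ?_ m
  have h := one_add_mul_le_pow (a := (1 : ℝ)) (by norm_num) k
  norm_num at h
  linarith

/-- A discrete Grönwall inequality with a geometrically bounded kernel. -/
theorem of_le_convolution {y w : ℕ → ℝ} (hw : GeomBounded w) (hy : ∀ j, 0 ≤ y j) {C : ℝ}
    (hC : 0 ≤ C) (J : ℕ) (h : ∀ j, J ≤ j → y j ≤ C * ∑ a ∈ Finset.range j, w (j - a) * y a) :
    GeomBounded y := by
  obtain ⟨A, S, hA, hS, hw⟩ := hw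
  -- With this ratio `C A (1 + r + ⋯ + r^{j-1}) = r^j - 1`, so the induction closes with the same
  -- constant `B`.
  set r : ℝ := 1 + C * A with hr
  have hr1 : 1 ≤ r := by
    have : 0 ≤ C * A := by positivity
    linarith
  have hgeom : ∀ j : ℕ, C * A * ∑ a ∈ Finset.range j, r ^ a ≤ r ^ j := by
    intro j
    have h1 := geom_sum_mul r j
    have h2 : r - 1 = C * A := by rw [hr]; ring
    rw [h2] at h1
    linarith
  -- The recursion is silent below `J`; this constant dominates each of those initial values.
  set B : ℝ := ∑ j ∈ Finset.range J, y j with hB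
  have hB0 : 0 ≤ B := Finset.sum_nonneg fun j _ => hy j
  have hT : 1 ≤ S * r := one_le_mul_of_one_le_of_one_le hS hr1
  refine ⟨B, S * r, hB0, hT, fun j => ?_⟩
  induction j using Nat.strong_induction_on with
  | _ j ih =>
    rcases lt_or_ge j J with hj | hj
    · calc y j ≤ B := Finset.single_le_sum (fun i _ => hy i) (Finset.mem_range.2 hj)
        _ = B * 1 := (mul_one B).symm
        _ ≤ B * (S * r) ^ j := by
          gcongr
          exact one_le_pow₀ hT
    · refine (h j hj).trans ?_
      calc C * ∑ a ∈ Finset.range j, w (j - a) * y a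
          ≤ C * ∑ a ∈ Finset.range j, (A * S ^ (j - a)) * (B * (S * r) ^ a) := by
            gcongr with a ha
            · exact hy a
            · exact hw _
            · exact ih a (Finset.mem_range.1 ha)
        _ = B * S ^ j * (C * A * ∑ a ∈ Finset.range j, r ^ a) := by
            simp only [Finset.mul_sum]
            refine Finset.sum_congr rfl fun a ha => ?_
            rw [← Nat.sub_add_cancel (Finset.mem_range.1 ha).le, pow_add, mul_pow,
              Nat.add_sub_cancel]
            ring
        _ ≤ B * S ^ j * r ^ j := by
            gcongr
            exact hgeom j
        _ = _ := by rw [mul_pow]; ring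

end GeomBounded

/-! ### Taylor coefficients of germs -/

theorem taylorCoeff_add (k : ℕ) (φ ψ : HoloGerm) :
    taylorCoeff k (φ + ψ) = taylorCoeff k φ + taylorCoeff k ψ := by
  obtain ⟨f, hf, rfl⟩ := exists_germOf φ
  obtain ⟨g, hg, rfl⟩ := exists_germOf ψ
  change iteratedDeriv k (f + g) 0 / _ = _
  rw [iteratedDeriv_add hf.contDiffAt hg.contDiffAt, add_div]
  rfl

theorem taylorCoeff_zero_right (k : ℕ) : taylorCoeff k 0 = 0 := by
  have := taylorCoeff_add k 0 0
  simpa using this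

/-- `taylorCoeff` as an additive homomorphism. -/
noncomputable def taylorHom (k : ℕ) : HoloGerm →+ ℂ where
  toFun := taylorCoeff k
  map_zero' := taylorCoeff_zero_right k
  map_add' := taylorCoeff_add k

theorem taylorCoeff_sum {ι : Type*} (k : ℕ) (s : Finset ι) (φ : ι → HoloGerm) :
    taylorCoeff k (∑ i ∈ s, φ i) = ∑ i ∈ s, taylorCoeff k (φ i) :=
  map_sum (taylorHom k) φ s

theorem taylorCoeff_mul (k : ℕ) (φ ψ : HoloGerm) :
    taylorCoeff k (φ * ψ)
      = ∑ x ∈ Finset.HasAntidiagonal.antidiagonal k, taylorCoeff x.1 φ * taylorCoeff x.2 ψ := by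
  obtain ⟨f, hf, rfl⟩ := exists_germOf φ
  obtain ⟨g, hg, rfl⟩ := exists_germOf ψ
  change iteratedDeriv k (f * g) 0 / _ = _
  rw [iteratedDeriv_mul hf.contDiffAt hg.contDiffAt, Finset.sum_div,
    Finset.Nat.sum_antidiagonal_eq_sum_range_succ_mk]
  refine Finset.sum_congr rfl fun i hi => ?_
  rw [taylorCoeff_germOf, taylorCoeff_germOf,
    Nat.cast_choose ℂ (Nat.lt_succ_iff.1 (Finset.mem_range.1 hi))]
  have h1 : (k.factorial : ℂ) ≠ 0 := Nat.cast_ne_zero.2 k.factorial_ne_zero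
  field_simp

theorem taylorCoeff_const (k : ℕ) (c : ℂ) :
    taylorCoeff k (algebraMap ℂ HoloGerm c) = if k = 0 then c else 0 := by
  change iteratedDeriv k (fun _ => c) 0 / _ = _
  rw [iteratedDeriv_const]
  split_ifs with h <;> simp [h]

theorem taylorCoeff_tGerm_pow (k j : ℕ) : taylorCoeff k (tGerm ^ j) = if k = j then 1 else 0 := by
  rw [tGerm_pow, taylorCoeff_germOf, iteratedDeriv_fun_pow_zero]
  split_ifs with h
  · subst h
    exact div_self (Nat.cast_ne_zero.2 k.factorial_ne_zero)
  · simp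

theorem taylorCoeff_tGerm_pow_mul_const (k j : ℕ) (c : ℂ) :
    taylorCoeff k (tGerm ^ j * algebraMap ℂ HoloGerm c) = if k = j then c else 0 := by
  rw [taylorCoeff_mul, Finset.sum_eq_single (k, 0)]
  · simp [taylorCoeff_tGerm_pow, taylorCoeff_const]
  · rintro ⟨a, b⟩ hx hne
    rcases eq_or_ne b 0 with rfl | hb
    · exact absurd (by simpa using hx) (fun h : a = k => hne (by rw [h]))
    · simp [taylorCoeff_const, hb]
  · intro h
    simp at h

theorem taylorCoeff_derivGerm (k : ℕ) (φ : HoloGerm) :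
    taylorCoeff k (derivGerm φ) = (k + 1) * taylorCoeff (k + 1) φ := by
  obtain ⟨f, hf, rfl⟩ := exists_germOf φ
  rw [derivGerm_germOf, taylorCoeff_germOf, taylorCoeff_germOf, iteratedDeriv_succ',
    Nat.factorial_succ]
  have h1 : (k.factorial : ℂ) ≠ 0 := Nat.cast_ne_zero.2 k.factorial_ne_zero
  have h2 : (k : ℂ) + 1 ≠ 0 := Nat.cast_add_one_ne_zero k
  push_cast
  field_simp

theorem taylorCoeff_euler (k : ℕ) (φ : HoloGerm) :
    taylorCoeff k (euler φ) = k * taylorCoeff k φ := by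
  change taylorCoeff k (tGerm * derivGerm φ) = _
  have ht : ∀ a, taylorCoeff a tGerm = if a = 1 then 1 else 0 := fun a => by
    simpa using taylorCoeff_tGerm_pow a 1
  rw [taylorCoeff_mul]
  cases k with
  | zero => simp [ht]
  | succ k =>
    rw [Finset.sum_eq_single (1, k)]
    · simp [ht, taylorCoeff_derivGerm]
    · rintro ⟨a, b⟩ hx hne
      have : a ≠ 1 := by
        rintro rfl
        apply hne
        have := Finset.HasAntidiagonal.mem_antidiagonal.1 hx
        simp only [Prod.mk.injEq, true_and]
        simp only at this
        omega
      simp [ht, this]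
    · intro h
      exact absurd (Finset.HasAntidiagonal.mem_antidiagonal.2 (add_comm 1 k)) h

theorem taylorCoeff_euler_pow (i k : ℕ) (φ : HoloGerm) :
    taylorCoeff k ((euler ^ i) φ) = (k : ℂ) ^ i * taylorCoeff k φ := by
  induction i with
  | zero => simp
  | succ i ih => rw [pow_succ', Module.End.mul_apply, taylorCoeff_euler, ih, pow_succ', mul_assoc]

theorem hasFPowerSeriesAt_germOf {f : ℂ → ℂ} (hf : AnalyticAt ℂ f 0) :
    HasFPowerSeriesAt f (FormalMultilinearSeries.ofScalars ℂ
      (fun k => taylorCoeff k (germOf f hf))) 0 :=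
  hf.hasFPowerSeriesAt

theorem germ_ext {φ ψ : HoloGerm} (h : ∀ k, taylorCoeff k φ = taylorCoeff k ψ) : φ = ψ := by
  obtain ⟨f, hf, rfl⟩ := exists_germOf φ
  obtain ⟨g, hg, rfl⟩ := exists_germOf ψ
  rw [germOf_eq_iff]
  have h1 := hasFPowerSeriesAt_germOf hf
  rw [funext h] at h1
  have h2 := h1.sub (hasFPowerSeriesAt_germOf hg)
  rw [sub_self] at h2
  filter_upwards [h2.eventually_eq_zero] with z hz
  exact sub_eq_zero.1 hz

theorem geomBounded_taylorCoeff (φ : HoloGerm) : GeomBounded (fun k => ‖taylorCoeff k φ‖) := by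
  obtain ⟨f, hf, rfl⟩ := exists_germOf φ
  obtain ⟨C, r, hC, hr, h⟩ := FormalMultilinearSeries.le_mul_pow_of_radius_pos _
    (hasFPowerSeriesAt_germOf hf).radius_pos
  refine ⟨C, max 1 r, hC.le, le_max_left _ _, fun k => ?_⟩
  have hk := h k
  rw [FormalMultilinearSeries.ofScalars_norm] at hk
  refine hk.trans ?_
  gcongr
  exact le_max_right _ _

/-- A geometrically bounded sequence is the sequence of Taylor coefficients of a germ. -/
theorem exists_germ_of_geomBounded {a : ℕ → ℂ} (h : GeomBounded (fun k => ‖a k‖)) :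
    ∃ φ : HoloGerm, ∀ k, taylorCoeff k φ = a k := by
  obtain ⟨A, S, hA, hS, h⟩ := h
  have hS0 : 0 < S := by linarith
  set p := FormalMultilinearSeries.ofScalars ℂ a with hp
  have hr : 0 < p.radius := by
    refine lt_of_lt_of_le ?_ (p.le_radius_of_bound (r := ⟨S⁻¹, by positivity⟩) A fun k => ?_)
    · exact ENNReal.coe_pos.2 (show (0 : ℝ) < S⁻¹ by positivity)
    · rw [hp, FormalMultilinearSeries.ofScalars_norm]
      change ‖a k‖ * S⁻¹ ^ k ≤ A
      rw [inv_pow, ← div_eq_mul_inv, div_le_iff₀ (by positivity)]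
      exact h k
  have hf := (p.hasFPowerSeriesOnBall hr).hasFPowerSeriesAt
  refine ⟨germOf p.sum hf.analyticAt, fun k => ?_⟩
  have := (hasFPowerSeriesAt_germOf hf.analyticAt).eq_formalMultilinearSeries hf
  exact congrFun (FormalMultilinearSeries.ofScalars_series_injective (𝕜 := ℂ) ℂ (this.trans hp)) k

/-! ### Taylor parts of operators -/

theorem coeff_taylorPart (k : ℕ) (P : DiffOp) (i : ℕ) :
    (taylorPart k P).coeff i = taylorCoeff k (P.coeff i) := by
  rw [taylorPart, finsetSum_coeff]
  simp only [coeff_monomial, Finset.sum_ite_eq', Finset.mem_range]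
  split_ifs with h
  · rfl
  · rw [coeff_eq_zero_of_natDegree_lt (by omega), taylorCoeff_zero_right]

theorem natDegree_taylorPart_le (k : ℕ) (P : DiffOp) :
    (taylorPart k P).natDegree ≤ P.natDegree := by
  rw [natDegree_le_iff_coeff_eq_zero]
  intro i hi
  rw [coeff_taylorPart, coeff_eq_zero_of_natDegree_lt hi, taylorCoeff_zero_right]

/-- Used to read off the order and the Fuchsian property of `H`, `K`, `M` from their expansions
alone. -/
theorem natDegree_eq_of_taylorPart {P : DiffOp} {n : ℕ}
    (h : ∀ k, (taylorPart k P).natDegree ≤ n) (h0 : (taylorPart 0 P).coeff n ≠ 0) :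
    P.natDegree = n ∧ IsFuchsian P := by
  rw [coeff_taylorPart] at h0
  have hle : P.natDegree ≤ n := by
    rw [natDegree_le_iff_coeff_eq_zero]
    intro i hi
    refine germ_ext fun k => ?_
    rw [← coeff_taylorPart, coeff_eq_zero_of_natDegree_lt ((h k).trans_lt hi),
      taylorCoeff_zero_right]
  have heq : P.natDegree = n := by
    refine le_antisymm hle (le_natDegree_of_ne_zero fun hz => h0 ?_)
    rw [hz, taylorCoeff_zero_right]
  refine ⟨heq, ?_⟩
  rw [IsFuchsian, leadingCoeff, heq]
  exact h0

theorem IsFuchsian.coeff_eulerPart_ne_zero {P : DiffOp} (hP : IsFuchsian P) :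
    (eulerPart P).coeff P.natDegree ≠ 0 := by
  rw [eulerPart, coeff_taylorPart]
  exact hP

theorem taylorPart_eulerOp_add_sum (p : ℂ[X]) (N : ℕ) (q : ℕ → ℂ[X]) (k : ℕ) :
    taylorPart k (eulerOp p + ∑ j ∈ Finset.Icc 1 N, tPowOp j (q j))
      = if k = 0 then p else if k ≤ N then q k else 0 := by
  ext i
  rw [coeff_taylorPart, coeff_add, finsetSum_coeff, taylorCoeff_add, taylorCoeff_sum]
  simp only [eulerOp, tPowOp, coeff_map, coeff_C_mul, taylorCoeff_const,
    taylorCoeff_tGerm_pow_mul_const, Finset.sum_ite_eq, Finset.mem_Icc]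
  rcases Nat.eq_zero_or_pos k with rfl | hk
  · simp
  · by_cases hN : k ≤ N
    · simp [hk.ne', hN, Nat.one_le_iff_ne_zero]
    · simp [hk.ne', hN]

/-- Since `ε` multiplies `t^b` by `b`, the polynomial `p_a(ε)` acts on `t^b` as the number `p_a(b)`,
and `t^a` raises the exponent. -/
theorem taylorCoeff_toOp (k : ℕ) (P : DiffOp) (u : HoloGerm) :
    taylorCoeff k (toOp P u) = ∑ x ∈ Finset.HasAntidiagonal.antidiagonal k,
      (taylorPart x.1 P).eval (x.2 : ℂ) * taylorCoeff x.2 u := by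
  rw [toOp_apply, taylorCoeff_sum]
  simp only [taylorCoeff_mul, taylorCoeff_euler_pow]
  rw [Finset.sum_comm]
  refine Finset.sum_congr rfl fun x _ => ?_
  rw [eval_eq_sum_range' (Nat.lt_succ_of_le (natDegree_taylorPart_le x.1 P)), Finset.sum_mul]
  exact Finset.sum_congr rfl fun i _ => by rw [coeff_taylorPart, mul_assoc]

theorem eval_shift (j : ℕ) (w : ℂ[X]) (z : ℂ) : (shift j w).eval z = w.eval (z + j) := by
  simp [shift]

theorem taylorCoeff_toOp_mul_toOp (k : ℕ) (P Q : DiffOp) (u : HoloGerm) :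
    taylorCoeff k ((toOp P * toOp Q) u) = ∑ x ∈ Finset.HasAntidiagonal.antidiagonal k,
      (∑ y ∈ Finset.HasAntidiagonal.antidiagonal x.1, shift y.2 (taylorPart y.1 P) * taylorPart y.2 Q).eval
        (x.2 : ℂ) * taylorCoeff x.2 u := by
  rw [Module.End.mul_apply, taylorCoeff_toOp]
  simp only [taylorCoeff_toOp, Finset.mul_sum, eval_finsetSum, Finset.sum_mul, eval_mul,
    eval_shift]
  rw [Finset.sum_sigma', Finset.sum_sigma']
  -- Both sides run over triples with `a + c + d = k`, bracketed as `a + (c + d)` and `(a + c) + d`.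
  refine Finset.sum_nbij' (fun z => ⟨(z.1.1 + z.2.1, z.2.2), (z.1.1, z.2.1)⟩)
    (fun z => ⟨(z.2.1, z.2.2 + z.1.2), (z.2.2, z.1.2)⟩) ?_ ?_ ?_ ?_ ?_
  · rintro ⟨⟨a, b⟩, ⟨c, d⟩⟩ hz
    simp only [Finset.mem_sigma, Finset.HasAntidiagonal.mem_antidiagonal] at hz ⊢
    obtain ⟨rfl, rfl⟩ := hz
    simp [add_assoc]
  · rintro ⟨⟨a, b⟩, ⟨c, d⟩⟩ hz
    simp only [Finset.mem_sigma, Finset.HasAntidiagonal.mem_antidiagonal] at hz ⊢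
    obtain ⟨rfl, rfl⟩ := hz
    simp [add_assoc]
  · rintro ⟨⟨a, b⟩, ⟨c, d⟩⟩ hz
    simp only [Finset.mem_sigma, Finset.HasAntidiagonal.mem_antidiagonal] at hz
    obtain ⟨-, rfl⟩ := hz
    rfl
  · rintro ⟨⟨a, b⟩, ⟨c, d⟩⟩ hz
    simp only [Finset.mem_sigma, Finset.HasAntidiagonal.mem_antidiagonal] at hz
    obtain ⟨-, rfl⟩ := hz
    rfl
  · rintro ⟨⟨a, b⟩, ⟨c, d⟩⟩ hz
    simp only [Finset.mem_sigma, Finset.HasAntidiagonal.mem_antidiagonal] at hz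
    obtain ⟨-, rfl⟩ := hz
    push_cast
    rw [add_comm (d : ℂ), mul_assoc]

theorem toOp_mul_toOp_eq_of_taylorPart {P Q P' Q' : DiffOp}
    (h : ∀ k, ∑ y ∈ Finset.HasAntidiagonal.antidiagonal k,
        shift y.2 (taylorPart y.1 P) * taylorPart y.2 Q
      = ∑ y ∈ Finset.HasAntidiagonal.antidiagonal k,
        shift y.2 (taylorPart y.1 P') * taylorPart y.2 Q') :
    toOp P * toOp Q = toOp P' * toOp Q' := by
  refine LinearMap.ext fun u => germ_ext fun k => ?_
  rw [taylorCoeff_toOp_mul_toOp, taylorCoeff_toOp_mul_toOp]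
  simp only [h]


/-! ### The `ℓ¹` norm of a polynomial -/

/-- The sum of the absolute values of the coefficients. -/
noncomputable def polyNorm (p : ℂ[X]) : ℝ := p.sum fun _ a => ‖a‖

theorem polyNorm_eq_sum_range {p : ℂ[X]} {n : ℕ} (h : p.natDegree < n) :
    polyNorm p = ∑ i ∈ Finset.range n, ‖p.coeff i‖ :=
  p.sum_over_range' (fun _ => norm_zero) n h

theorem polyNorm_nonneg (p : ℂ[X]) : 0 ≤ polyNorm p :=
  Finset.sum_nonneg fun _ _ => norm_nonneg _

theorem polyNorm_zero : polyNorm 0 = 0 := by simp [polyNorm]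

theorem polyNorm_monomial (i : ℕ) (c : ℂ) : polyNorm (monomial i c) = ‖c‖ := by
  simp [polyNorm]

theorem polyNorm_C (c : ℂ) : polyNorm (C c) = ‖c‖ := polyNorm_monomial 0 c

theorem polyNorm_X : polyNorm X = 1 := by
  rw [← monomial_one_one_eq_X, polyNorm_monomial, norm_one]

theorem norm_coeff_le_polyNorm (p : ℂ[X]) (i : ℕ) : ‖p.coeff i‖ ≤ polyNorm p := by
  rcases le_or_gt i p.natDegree with h | h
  · rw [polyNorm_eq_sum_range (Nat.lt_succ_self _)]
    exact Finset.single_le_sum (f := fun i => ‖p.coeff i‖) (fun _ _ => norm_nonneg _)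
      (Finset.mem_range.2 (Nat.lt_succ_of_le h))
  · rw [coeff_eq_zero_of_natDegree_lt h, norm_zero]
    exact polyNorm_nonneg p

theorem polyNorm_add_le (p q : ℂ[X]) : polyNorm (p + q) ≤ polyNorm p + polyNorm q := by
  set n := max p.natDegree q.natDegree + 1
  rw [polyNorm_eq_sum_range (n := n) (Nat.lt_succ_of_le (natDegree_add_le p q)),
    polyNorm_eq_sum_range (n := n) (Nat.lt_succ_of_le (le_max_left _ _)),
    polyNorm_eq_sum_range (n := n) (Nat.lt_succ_of_le (le_max_right _ _)), ← Finset.sum_add_distrib]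
  gcongr with i _
  rw [coeff_add]
  exact norm_add_le _ _

theorem polyNorm_neg (p : ℂ[X]) : polyNorm (-p) = polyNorm p := by
  rw [polyNorm_eq_sum_range (Nat.lt_succ_self p.natDegree),
    polyNorm_eq_sum_range (n := p.natDegree.succ) (by rw [natDegree_neg]; exact Nat.lt_succ_self _)]
  simp

theorem polyNorm_sub_le (p q : ℂ[X]) : polyNorm (p - q) ≤ polyNorm p + polyNorm q := by
  rw [sub_eq_add_neg, ← polyNorm_neg q]
  exact polyNorm_add_le p (-q)

theorem polyNorm_sum_le {ι : Type*} (s : Finset ι) (f : ι → ℂ[X]) :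
    polyNorm (∑ i ∈ s, f i) ≤ ∑ i ∈ s, polyNorm (f i) :=
  Finset.le_sum_of_subadditive polyNorm polyNorm_zero.le polyNorm_add_le s f

theorem polyNorm_mul_le (p q : ℂ[X]) : polyNorm (p * q) ≤ polyNorm p * polyNorm q := by
  have hp := polyNorm_eq_sum_range (Nat.lt_succ_self p.natDegree)
  have hq := polyNorm_eq_sum_range (Nat.lt_succ_self q.natDegree)
  rw [hp, hq, Finset.sum_mul_sum]
  conv_lhs => rw [p.as_sum_range, q.as_sum_range, Finset.sum_mul_sum]
  refine (polyNorm_sum_le _ _).trans (Finset.sum_le_sum fun i _ =>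
    (polyNorm_sum_le _ _).trans (Finset.sum_le_sum fun k _ => ?_))
  rw [monomial_mul_monomial, polyNorm_monomial, norm_mul]

theorem polyNorm_pow_le (p : ℂ[X]) (i : ℕ) : polyNorm (p ^ i) ≤ polyNorm p ^ i := by
  induction i with
  | zero => rw [pow_zero, pow_zero, ← C_1, polyNorm_C, norm_one]
  | succ i ih =>
    rw [pow_succ, pow_succ]
    exact (polyNorm_mul_le _ _).trans (mul_le_mul_of_nonneg_right ih (polyNorm_nonneg p))

/-- A linear operator on polynomials is bounded on polynomials of bounded degree. -/
theorem exists_polyNorm_le_of_linearMap (T : ℂ[X] →ₗ[ℂ] ℂ[X]) (D : ℕ) :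
    ∃ c : ℝ, 0 ≤ c ∧ ∀ f : ℂ[X], f.natDegree ≤ D → polyNorm (T f) ≤ c * polyNorm f := by
  refine ⟨∑ i ∈ Finset.range (D + 1), polyNorm (T (X ^ i)),
    Finset.sum_nonneg fun _ _ => polyNorm_nonneg _, fun f hf => ?_⟩
  have hT : T f = ∑ i ∈ Finset.range (D + 1), C (f.coeff i) * T (X ^ i) := by
    conv_lhs => rw [f.as_sum_range' (D + 1) (Nat.lt_succ_of_le hf)]
    rw [map_sum]
    refine Finset.sum_congr rfl fun i _ => ?_
    rw [← C_mul_X_pow_eq_monomial, ← smul_eq_C_mul, map_smul, smul_eq_C_mul]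
  rw [hT, Finset.sum_mul]
  refine (polyNorm_sum_le _ _).trans (Finset.sum_le_sum fun i _ => ?_)
  refine (polyNorm_mul_le _ _).trans ?_
  rw [polyNorm_C, mul_comm]
  exact mul_le_mul_of_nonneg_left (norm_coeff_le_polyNorm f i) (polyNorm_nonneg _)

/-- The remainder is linear in the dividend: `%` unfolds to division by the monic normalisation of
`p`. -/
theorem exists_polyNorm_mod_le (p : ℂ[X]) (D : ℕ) :
    ∃ c : ℝ, 0 ≤ c ∧ ∀ f : ℂ[X], f.natDegree ≤ D → polyNorm (f % p) ≤ c * polyNorm f :=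
  exists_polyNorm_le_of_linearMap (modByMonicHom (p * C p.leadingCoeff⁻¹)) D

/-- Multiplication by `p` is injective, so it has a linear left inverse, which is bounded in bounded
degree. -/
theorem exists_polyNorm_le_mul {p : ℂ[X]} (hp : p ≠ 0) (D : ℕ) :
    ∃ c : ℝ, 0 ≤ c ∧ ∀ g : ℂ[X], (g * p).natDegree ≤ D → polyNorm g ≤ c * polyNorm (g * p) := by
  obtain ⟨T, hT⟩ := (LinearMap.mulRight ℂ p).exists_leftInverse_of_injective
    (LinearMap.ker_eq_bot.2 (mul_left_injective₀ hp))
  obtain ⟨c, hc, h⟩ := exists_polyNorm_le_of_linearMap T D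
  refine ⟨c, hc, fun g hg => ?_⟩
  have := h _ hg
  rwa [show T (g * p) = g from LinearMap.congr_fun hT g] at this

/-! ### Shifts -/

theorem shift_zero (w : ℂ[X]) : shift 0 w = w := by simp [shift]

theorem natDegree_shift (j : ℕ) (w : ℂ[X]) : (shift j w).natDegree = w.natDegree :=
  natDegree_taylor w (j : ℂ)

theorem polyNorm_X_add_C_le (j : ℕ) : polyNorm (X + C (j : ℂ)) ≤ 1 + j := by
  refine (polyNorm_add_le _ _).trans ?_
  rw [polyNorm_X, polyNorm_C, Complex.norm_natCast]

theorem shift_eq_sum {n : ℕ} {w : ℂ[X]} (h : w.natDegree ≤ n) (j : ℕ) :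
    shift j w = ∑ i ∈ Finset.range (n + 1), C (w.coeff i) * (X + C (j : ℂ)) ^ i := by
  rw [shift, comp, eval₂_eq_sum_range' _ (Nat.lt_succ_of_le h)]

theorem polyNorm_shift_le {n : ℕ} {w : ℂ[X]} (h : w.natDegree ≤ n) (j : ℕ) :
    polyNorm (shift j w) ≤ (1 + (j : ℝ)) ^ n * polyNorm w := by
  rw [shift_eq_sum h, polyNorm_eq_sum_range (Nat.lt_succ_of_le h), Finset.mul_sum]
  refine (polyNorm_sum_le _ _).trans (Finset.sum_le_sum fun i hi => ?_)
  refine (polyNorm_mul_le _ _).trans ?_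
  rw [polyNorm_C, mul_comm]
  gcongr
  refine (polyNorm_pow_le _ _).trans ?_
  calc polyNorm (X + C (j : ℂ)) ^ i ≤ (1 + (j : ℝ)) ^ i := by
        gcongr
        · exact polyNorm_nonneg _
        · exact polyNorm_X_add_C_le j
    _ ≤ _ := pow_le_pow_right₀ (by simp) (Nat.lt_succ_iff.1 (Finset.mem_range.1 hi))

/-- The difference is `O(j^{n-1})`; the factor `j` on the left avoids a negative exponent at `n =
0`. -/
theorem exists_polyNorm_X_add_C_pow_sub_le (n : ℕ) : ∃ c : ℝ, 0 ≤ c ∧ ∀ j : ℕ, 1 ≤ j →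
    polyNorm ((X + C (j : ℂ)) ^ n - C ((j : ℂ) ^ n)) * j ≤ c * (j : ℝ) ^ n := by
  induction n with
  | zero => exact ⟨0, le_rfl, fun j _ => by simp [polyNorm_zero]⟩
  | succ n ih =>
    obtain ⟨c, hc, h⟩ := ih
    refine ⟨2 * c + 1, by positivity, fun j hj => ?_⟩
    have hj' : (1 : ℝ) ≤ j := by exact_mod_cast hj
    have e : (X + C (j : ℂ)) ^ (n + 1) - C ((j : ℂ) ^ (n + 1))
        = (X + C (j : ℂ)) * ((X + C (j : ℂ)) ^ n - C ((j : ℂ) ^ n)) + X * C ((j : ℂ) ^ n) := by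
      rw [pow_succ (j : ℂ), C_mul]
      ring
    have h1 : polyNorm ((X + C (j : ℂ)) ^ (n + 1) - C ((j : ℂ) ^ (n + 1)))
        ≤ (1 + j) * polyNorm ((X + C (j : ℂ)) ^ n - C ((j : ℂ) ^ n)) + (j : ℝ) ^ n := by
      rw [e]
      refine (polyNorm_add_le _ _).trans (add_le_add ?_ ?_)
      · exact (polyNorm_mul_le _ _).trans
          (mul_le_mul_of_nonneg_right (polyNorm_X_add_C_le j) (polyNorm_nonneg _))
      · refine (polyNorm_mul_le _ _).trans ?_
        rw [polyNorm_X, polyNorm_C, norm_pow, Complex.norm_natCast, one_mul]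
    calc _ ≤ ((1 + j) * polyNorm ((X + C (j : ℂ)) ^ n - C ((j : ℂ) ^ n)) + (j : ℝ) ^ n) * j := by
          gcongr
      _ = (1 + j) * (polyNorm ((X + C (j : ℂ)) ^ n - C ((j : ℂ) ^ n)) * j) + (j : ℝ) ^ (n + 1) := by
          ring
      _ ≤ (1 + j) * (c * (j : ℝ) ^ n) + (j : ℝ) ^ (n + 1) := by
          exact add_le_add_left (mul_le_mul_of_nonneg_left (h j hj) (by positivity)) _
      _ ≤ (2 * j) * (c * (j : ℝ) ^ n) + (j : ℝ) ^ (n + 1) := by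
          gcongr
          linarith
      _ = _ := by ring

/-- The shift `p^{[j]}` is `lc(p) j^n + O(j^{n-1})` as `j → ∞`. -/
theorem exists_polyNorm_shift_sub_le (p : ℂ[X]) : ∃ c : ℝ, 0 ≤ c ∧ ∀ j : ℕ, 1 ≤ j →
    polyNorm (shift j p - C (p.leadingCoeff * (j : ℂ) ^ p.natDegree)) * j
      ≤ c * (j : ℝ) ^ p.natDegree := by
  obtain ⟨c, hc, h⟩ := exists_polyNorm_X_add_C_pow_sub_le p.natDegree
  set n := p.natDegree
  refine ⟨(∑ i ∈ Finset.range n, ‖p.coeff i‖ * 2 ^ i) + ‖p.leadingCoeff‖ * c, by positivity,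
    fun j hj => ?_⟩
  have hj' : (1 : ℝ) ≤ j := by exact_mod_cast hj
  have e : shift j p - C (p.leadingCoeff * (j : ℂ) ^ n)
      = (∑ i ∈ Finset.range n, C (p.coeff i) * (X + C (j : ℂ)) ^ i)
        + C p.leadingCoeff * ((X + C (j : ℂ)) ^ n - C ((j : ℂ) ^ n)) := by
    rw [shift_eq_sum le_rfl, Finset.sum_range_succ, C_mul, leadingCoeff]
    ring
  rw [e, add_mul]
  refine (mul_le_mul_of_nonneg_right (polyNorm_add_le _ _) (by positivity)).trans ?_
  rw [add_mul]
  refine add_le_add ?_ ?_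
  · refine (mul_le_mul_of_nonneg_right (polyNorm_sum_le _ _) (by positivity)).trans ?_
    rw [Finset.sum_mul, Finset.sum_mul]
    refine Finset.sum_le_sum fun i hi => ?_
    have h1 : polyNorm (C (p.coeff i) * (X + C (j : ℂ)) ^ i) ≤ ‖p.coeff i‖ * (2 * (j : ℝ)) ^ i := by
      refine (polyNorm_mul_le _ _).trans ?_
      rw [polyNorm_C]
      gcongr
      refine (polyNorm_pow_le _ _).trans (pow_le_pow_left₀ (polyNorm_nonneg _) ?_ i)
      exact (polyNorm_X_add_C_le j).trans (by linarith)
    calc _ ≤ ‖p.coeff i‖ * (2 * (j : ℝ)) ^ i * j := by gcongr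
      _ = ‖p.coeff i‖ * 2 ^ i * (j : ℝ) ^ (i + 1) := by rw [mul_pow]; ring
      _ ≤ _ := by
        gcongr
        exact Finset.mem_range.1 hi
  · calc _ ≤ ‖p.leadingCoeff‖ * polyNorm ((X + C (j : ℂ)) ^ n - C ((j : ℂ) ^ n)) * j := by
          gcongr
          refine (polyNorm_mul_le _ _).trans ?_
          rw [polyNorm_C]
      _ = ‖p.leadingCoeff‖ * (polyNorm ((X + C (j : ℂ)) ^ n - C ((j : ℂ) ^ n)) * j) := by ring
      _ ≤ ‖p.leadingCoeff‖ * (c * (j : ℝ) ^ n) := by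
          exact mul_le_mul_of_nonneg_left (h j hj) (norm_nonneg _)
      _ = _ := by ring

/-- For large `j` multiplication by `p^{[j]}` modulo `p` is bounded below by a multiple
of `j ^ deg p`. -/
theorem exists_pow_mul_polyNorm_le {p : ℂ[X]} (hp : p ≠ 0) : ∃ (c : ℝ) (J : ℕ), 0 ≤ c ∧ 1 ≤ J ∧
    ∀ j : ℕ, J ≤ j → ∀ h : ℂ[X], h.degree < p.degree →
      (j : ℝ) ^ p.natDegree * polyNorm h ≤ c * polyNorm (shift j p * h % p) := by
  obtain ⟨c₁, hc₁, hmod⟩ := exists_polyNorm_mod_le p (p.natDegree + p.natDegree)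
  obtain ⟨c₂, hc₂, hshift⟩ := exists_polyNorm_shift_sub_le p
  set n := p.natDegree with hn
  set l := ‖p.leadingCoeff‖ with hl
  have hl0 : 0 < l := norm_pos_iff.2 (leadingCoeff_ne_zero.2 hp)
  obtain ⟨J, hJ⟩ := exists_nat_ge (2 * c₁ * c₂ / l)
  refine ⟨2 / l, max J 1, by positivity, le_max_right _ _, fun j hj h hh => ?_⟩
  have hj1 : 1 ≤ j := (le_max_right _ _).trans hj
  have hj0 : (0 : ℝ) < j := by exact_mod_cast hj1
  have hJj : 2 * c₁ * c₂ ≤ l * j := by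
    have : 2 * c₁ * c₂ / l ≤ j := hJ.trans (by exact_mod_cast (le_max_left _ _).trans hj)
    rw [div_le_iff₀ hl0] at this
    linarith
  set D := shift j p - C (p.leadingCoeff * (j : ℂ) ^ n) with hD
  set x := polyNorm (shift j p * h % p)
  have hhn : h.natDegree ≤ n := natDegree_le_natDegree hh.le
  have hDn : D.natDegree ≤ n := by
    refine (natDegree_sub_le _ _).trans (max_le (natDegree_shift j p).le ?_)
    rw [natDegree_C]
    exact Nat.zero_le _
  have key : C (p.leadingCoeff * (j : ℂ) ^ n) * h = shift j p * h % p - D * h % p := by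
    have h1 : C (p.leadingCoeff * (j : ℂ) ^ n) * h % p = C (p.leadingCoeff * (j : ℂ) ^ n) * h := by
      rw [mod_eq_self_iff hp]
      rw [← smul_eq_C_mul]
      exact (degree_smul_le _ _).trans_lt hh
    rw [← h1, ← sub_mod, hD]
    congr 1
    ring
  have hlow : l * ((j : ℝ) ^ n * polyNorm h) ≤ polyNorm (C (p.leadingCoeff * (j : ℂ) ^ n) * h) := by
    have h2 : h = C (p.leadingCoeff * (j : ℂ) ^ n)⁻¹ * (C (p.leadingCoeff * (j : ℂ) ^ n) * h) := by
      rw [← mul_assoc, ← C_mul, inv_mul_cancel₀, C_1, one_mul]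
      exact mul_ne_zero (leadingCoeff_ne_zero.2 hp) (pow_ne_zero _ (by exact_mod_cast hj0.ne'))
    have h3 := polyNorm_mul_le (C (p.leadingCoeff * (j : ℂ) ^ n)⁻¹)
      (C (p.leadingCoeff * (j : ℂ) ^ n) * h)
    rw [← h2, polyNorm_C, norm_inv, norm_mul, norm_pow, Complex.norm_natCast, inv_mul_eq_div,
      le_div_iff₀ (by positivity)] at h3
    linarith
  have h4 : polyNorm (D * h % p) ≤ c₁ * (polyNorm D * polyNorm h) :=
    (hmod _ (natDegree_mul_le.trans (add_le_add hDn hhn))).trans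
      (mul_le_mul_of_nonneg_left (polyNorm_mul_le _ _) hc₁)
  have h5 : l * ((j : ℝ) ^ n * polyNorm h) ≤ x + c₁ * (polyNorm D * polyNorm h) := by
    rw [key] at hlow
    exact hlow.trans ((polyNorm_sub_le _ _).trans (add_le_add le_rfl h4))
  have h6 : polyNorm D * j ≤ c₂ * (j : ℝ) ^ n := hshift j hj1
  have hY : 0 ≤ (j : ℝ) ^ n * polyNorm h := mul_nonneg (by positivity) (polyNorm_nonneg h)
  set Y := (j : ℝ) ^ n * polyNorm h
  have h7 : l * Y * j ≤ x * j + c₁ * c₂ * Y := by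
    calc l * Y * j ≤ (x + c₁ * (polyNorm D * polyNorm h)) * j := by gcongr
      _ = x * j + c₁ * (polyNorm D * j * polyNorm h) := by ring
      _ ≤ x * j + c₁ * (c₂ * (j : ℝ) ^ n * polyNorm h) := by
        gcongr
        exact polyNorm_nonneg h
      _ = _ := by simp only [Y]; ring
  have h8 : 2 * c₁ * c₂ * Y ≤ l * j * Y := mul_le_mul_of_nonneg_right hJj hY
  have h9 : l * Y * j ≤ 2 * x * j := by linarith
  have h10 : l * Y ≤ 2 * x := le_of_mul_le_mul_right h9 hj0
  rw [div_mul_eq_mul_div, le_div_iff₀ hl0]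
  linarith

/-! ### The homological equation -/

theorem nu_le (p : ℂ[X]) (hp : p ≠ 0) (j : ℕ) : nu p j ≤ p.natDegree :=
  natDegree_le_of_dvd (EuclideanDomain.gcd_dvd_left _ _) hp

theorem nu_eq_zero_of_isNonresonantOrder {p : ℂ[X]} {j : ℕ} (h : IsNonresonantOrder p j) :
    nu p j = 0 := by
  by_contra hne
  obtain ⟨z, hz⟩ := IsAlgClosed.exists_root (EuclideanDomain.gcd p (shift j p))
    (fun h0 => hne (natDegree_eq_of_degree_eq_some h0))
  have h1 : p.IsRoot z := hz.dvd (EuclideanDomain.gcd_dvd_left _ _)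
  have h2 : (shift j p).IsRoot z := hz.dvd (EuclideanDomain.gcd_dvd_right _ _)
  rw [IsRoot, eval_shift] at h2
  exact h (z + j) z h2 h1 (by ring)

/-- The roots have finitely many differences. This is what makes the normal form polynomial in `t`.
-/
theorem exists_forall_lt_isNonresonantOrder {p : ℂ[X]} (hp : p ≠ 0) :
    ∃ N : ℕ, ∀ j, N < j → IsNonresonantOrder p j := by
  have hfin : {z : ℂ | p.IsRoot z}.Finite := finite_setOfPred_isRoot hp
  have h2 := ((hfin.prod hfin).image fun x : ℂ × ℂ => x.1 - x.2)
  have h3 := h2.preimage (f := fun j : ℕ => (j : ℂ)) Nat.cast_injective.injOn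
  obtain ⟨N, hN⟩ := h3.bddAbove
  refine ⟨N, fun j hj a b ha hb hab => ?_⟩
  exact absurd (hN (show j ∈ _ from ⟨(a, b), ⟨ha, hb⟩, hab⟩)) (not_le.2 hj)

theorem exists_homological_solution {p h₀ : ℂ[X]} (hp : p ≠ 0) (hc : IsCoprime h₀ p) (j : ℕ)
    (F : ℂ[X]) : ∃ h g q : ℂ[X], shift j p * h + q * h₀ = g * p + F ∧
      h.degree < p.degree ∧ q.degree < (nu p j : WithBot ℕ) := by
  set d := EuclideanDomain.gcd p (shift j p) with hd
  have hdp : d ∣ p := EuclideanDomain.gcd_dvd_left _ _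
  have hd0 : d ≠ 0 := fun h => hp (zero_dvd_iff.1 (h ▸ hdp))
  obtain ⟨u, v, huv⟩ := hc.of_isCoprime_of_dvd_right hdp
  -- As `u h₀ + v d = 1`, the factor `u` inverts `h₀` modulo `d`, so `q = F u mod d` cancels `F`
  -- there.
  have hdvd : d ∣ F - (F * u % d) * h₀ := by
    have h1 : F * u % d = F * u - d * (F * u / d) := by
      rw [eq_sub_iff_add_eq', EuclideanDomain.div_add_mod]
    refine ⟨F * v + F * u / d * h₀, ?_⟩
    rw [h1]
    linear_combination (-F) * huv
  obtain ⟨w, hw⟩ := hdvd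
  have hbez : d = p * EuclideanDomain.gcdA p (shift j p)
      + shift j p * EuclideanDomain.gcdB p (shift j p) := EuclideanDomain.gcd_eq_gcd_ab _ _
  set x := EuclideanDomain.gcdA p (shift j p)
  set y := EuclideanDomain.gcdB p (shift j p)
  -- Bézout for `d` solves the equation with `h = y w`; reducing `h` modulo `p` moves the quotient
  -- into `g`.
  refine ⟨y * w % p, -(x * w) - shift j p * (y * w / p), F * u % d, ?_, degree_mod_lt _ hp, ?_⟩
  · have h2 : y * w % p = y * w - p * (y * w / p) := by
      rw [eq_sub_iff_add_eq', EuclideanDomain.div_add_mod]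
    rw [h2]
    linear_combination (-1 : ℂ[X]) * hw - w * hbez
  · rw [nu, ← degree_eq_natDegree hd0]
    exact degree_mod_lt _ hd0

/-! ### Formal solution of `M H = K L` -/

/-- Dependent choice along `ℕ` with values depending on all the previous ones. -/
theorem exists_seq_of_step {α : Type*} [Inhabited α] (x₀ : α) (step : ℕ → (ℕ → α) → α)
    (hstep : ∀ j f f', (∀ i < j, f i = f' i) → step j f = step j f') :
    ∃ f : ℕ → α, f 0 = x₀ ∧ ∀ j, 1 ≤ j → f j = step j f := by
  let G : ∀ j : ℕ, (∀ i, i < j → α) → α := fun j F =>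
    if j = 0 then x₀ else step j fun i => if h : i < j then F i h else default
  let f : ℕ → α := fun j => WellFounded.fix Nat.lt_wfRel.wf G j
  have hf : ∀ j, f j = G j fun i _ => f i := fun j => WellFounded.fix_eq _ _ _
  refine ⟨f, ?_, fun j hj => ?_⟩
  · rw [hf]
    simp [G]
  · rw [hf]
    simp only [G, if_neg (Nat.one_le_iff_ne_zero.1 hj)]
    exact hstep _ _ _ fun i hi => by simp [hi]

/-- The part of the equation of order `j` for `M H = K L` which only involves the terms of `H`, `K`
and `M` of order less than `j`. -/
noncomputable def lowerTerms (p h g q : ℕ → ℂ[X]) (j : ℕ) : ℂ[X] :=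
  ∑ a ∈ Finset.range j, shift (j - a) (g a) * p (j - a)
    - ∑ b ∈ Finset.Ico 1 j, shift b (q (j - b)) * h b

theorem exists_formal_solution {p : ℕ → ℂ[X]} {h₀ : ℂ[X]} (hp : p 0 ≠ 0)
    (hc : IsCoprime h₀ (p 0)) : ∃ h g q : ℕ → ℂ[X], h 0 = h₀ ∧ g 0 = h₀ ∧ q 0 = p 0 ∧ ∀ j, 1 ≤ j →
      shift j (p 0) * h j + q j * h₀ = g j * p 0 + lowerTerms p h g q j ∧
      (h j).degree < (p 0).degree ∧ (q j).degree < (nu (p 0) j : WithBot ℕ) := by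
  choose H G Q hHGQ using fun j F => exists_homological_solution hp hc j F
  let F : ℕ → (ℕ → ℂ[X] × ℂ[X] × ℂ[X]) → ℂ[X] := fun j f =>
    lowerTerms p (fun i => (f i).1) (fun i => (f i).2.1) (fun i => (f i).2.2) j
  obtain ⟨f, hf0, hf⟩ := exists_seq_of_step (h₀, h₀, p 0)
    (fun j f => (H j (F j f), G j (F j f), Q j (F j f))) (by
      intro j f f' hff
      have : F j f = F j f' := by
        simp only [F, lowerTerms]
        congr 1
        · exact Finset.sum_congr rfl fun a ha => by rw [hff a (Finset.mem_range.1 ha)]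
        · refine Finset.sum_congr rfl fun b hb => ?_
          have hb' := Finset.mem_Ico.1 hb
          rw [hff b hb'.2, hff (j - b) (by omega)]
      simp only [this])
  refine ⟨fun i => (f i).1, fun i => (f i).2.1, fun i => (f i).2.2, by simp [hf0],
    by simp [hf0], by simp [hf0],
    fun j hj => ?_⟩
  have h1 := hHGQ j (F j f)
  have h2 := hf j hj
  have e1 : (f j).1 = H j (F j f) := by rw [h2]
  have e2 : (f j).2.1 = G j (F j f) := by rw [h2]
  have e3 : (f j).2.2 = Q j (F j f) := by rw [h2]
  simp only [e1, e2, e3]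
  exact h1

theorem sum_antidiagonal_eq_of_formal_solution {p h g q : ℕ → ℂ[X]} {h₀ : ℂ[X]} (h0 : h 0 = h₀)
    (g0 : g 0 = h₀) (q0 : q 0 = p 0)
    (heq : ∀ j, 1 ≤ j → shift j (p 0) * h j + q j * h₀ = g j * p 0 + lowerTerms p h g q j)
    (j : ℕ) :
    ∑ y ∈ Finset.HasAntidiagonal.antidiagonal j, shift y.2 (q y.1) * h y.2
      = ∑ y ∈ Finset.HasAntidiagonal.antidiagonal j, shift y.2 (g y.1) * p y.2 := by
  rcases Nat.eq_zero_or_pos j with rfl | hj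
  · simp [h0, g0, q0, shift_zero, mul_comm]
  -- The swap indexes the left sum by the index of `h`. Its end terms `q_j h_0` and `p_0^{[j]} h_j`,
  -- and the term `g_j p_0` on the right, are then split off; the rest is `lowerTerms`.
  · rw [← Finset.Nat.sum_antidiagonal_swap, Finset.Nat.sum_antidiagonal_eq_sum_range_succ_mk,
      Finset.Nat.sum_antidiagonal_eq_sum_range_succ_mk, Finset.sum_range_succ,
      Finset.sum_range_succ, Finset.range_eq_Ico, Finset.sum_eq_sum_Ico_succ_bot hj]
    have h1 := heq j hj
    rw [lowerTerms, Finset.range_eq_Ico] at h1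
    simp only [Prod.swap_prod_mk, Nat.sub_self, Nat.sub_zero, shift_zero, q0, h0, zero_add]
    linear_combination h1

/-! ### Degree bounds and convergence -/

theorem natDegree_lowerTerms_le {p h g q : ℕ → ℂ[X]} {n m j : ℕ}
    (hp : ∀ k, (p k).natDegree ≤ n) (hg : ∀ a < j, (g a).natDegree ≤ m)
    (hq : ∀ k, 1 ≤ k → (q k).natDegree ≤ n) (hh : ∀ b, 1 ≤ b → (h b).natDegree ≤ m) :
    (lowerTerms p h g q j).natDegree ≤ m + n := by
  refine (natDegree_sub_le _ _).trans (max_le ?_ ?_)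
  · refine natDegree_sum_le_of_forall_le _ _ fun a ha => natDegree_mul_le.trans ?_
    rw [natDegree_shift]
    exact add_le_add (hg a (Finset.mem_range.1 ha)) (hp _)
  · refine natDegree_sum_le_of_forall_le _ _ fun b hb => natDegree_mul_le.trans ?_
    rw [natDegree_shift, add_comm]
    have hb' := Finset.mem_Ico.1 hb
    exact add_le_add (hh b hb'.1) (hq _ (by omega))


theorem polyNorm_lowerTerms_le {p h g q : ℕ → ℂ[X]} {n m : ℕ} (j : ℕ)
    (hg : ∀ a, (g a).natDegree ≤ m) (hq : ∀ k, 1 ≤ k → (q k).natDegree ≤ n) :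
    polyNorm (lowerTerms p h g q j) ≤ ∑ a ∈ Finset.range j,
      ((1 + ((j - a : ℕ) : ℝ)) ^ m * polyNorm (p (j - a)) + polyNorm (q (j - a)))
        * ((1 + (a : ℝ)) ^ n * polyNorm (h a) + polyNorm (g a)) := by
  have h1 : polyNorm (∑ a ∈ Finset.range j, shift (j - a) (g a) * p (j - a))
      ≤ ∑ a ∈ Finset.range j,
        (1 + ((j - a : ℕ) : ℝ)) ^ m * polyNorm (p (j - a)) * polyNorm (g a) := by
    refine (polyNorm_sum_le _ _).trans (Finset.sum_le_sum fun a _ => ?_)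
    refine (polyNorm_mul_le _ _).trans ?_
    refine (mul_le_mul_of_nonneg_right (polyNorm_shift_le (hg a) _) (polyNorm_nonneg _)).trans ?_
    exact le_of_eq (by ring)
  have h2 : polyNorm (∑ b ∈ Finset.Ico 1 j, shift b (q (j - b)) * h b)
      ≤ ∑ a ∈ Finset.range j, polyNorm (q (j - a)) * ((1 + (a : ℝ)) ^ n * polyNorm (h a)) := by
    refine (polyNorm_sum_le _ _).trans ((Finset.sum_le_sum fun b hb => ?_).trans
      (Finset.sum_le_sum_of_subset_of_nonneg (fun b hb =>
        Finset.mem_range.2 (Finset.mem_Ico.1 hb).2) fun a _ _ => ?_))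
    · have hb' := Finset.mem_Ico.1 hb
      refine (polyNorm_mul_le _ _).trans ?_
      refine (mul_le_mul_of_nonneg_right (polyNorm_shift_le (hq (j - b) (by omega)) _)
        (polyNorm_nonneg _)).trans ?_
      exact le_of_eq (by ring)
    · exact mul_nonneg (polyNorm_nonneg _) (mul_nonneg (by positivity) (polyNorm_nonneg _))
  refine (polyNorm_sub_le _ _).trans ((add_le_add h1 h2).trans ?_)
  rw [← Finset.sum_add_distrib]
  refine Finset.sum_le_sum fun a _ => ?_
  have e1 : 0 ≤ (1 + ((j - a : ℕ) : ℝ)) ^ m * polyNorm (p (j - a)) :=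
    mul_nonneg (by positivity) (polyNorm_nonneg _)
  have e2 : 0 ≤ (1 + (a : ℝ)) ^ n * polyNorm (h a) :=
    mul_nonneg (by positivity) (polyNorm_nonneg _)
  -- The two cross terms of the product are superfluous but nonnegative; admitting them merges both
  -- sums into one convolution.
  nlinarith [mul_nonneg e1 e2, mul_nonneg (polyNorm_nonneg (q (j - a))) (polyNorm_nonneg (g a))]

/-- All terms of the equation other than `g_j p_0` have degree at most `m + n`, and cancelling `p_0`
lowers the bound by `n`. Only `g_a` with `a < j` enter `lowerTerms`, so strong induction applies. -/
theorem natDegree_le_of_formal_solution {p h g q : ℕ → ℂ[X]} {h₀ : ℂ[X]} {n m : ℕ} (hp : p 0 ≠ 0)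
    (hn : (p 0).natDegree = n) (hpn : ∀ k, (p k).natDegree ≤ n) (hnm : n ≤ m)
    (hh₀ : h₀.natDegree ≤ m) (g0 : g 0 = h₀)
    (heq : ∀ j, 1 ≤ j → shift j (p 0) * h j + q j * h₀ = g j * p 0 + lowerTerms p h g q j)
    (hh : ∀ j, 1 ≤ j → (h j).natDegree ≤ n) (hq : ∀ j, 1 ≤ j → (q j).natDegree ≤ n) (j : ℕ) :
    (g j).natDegree ≤ m := by
  induction j using Nat.strong_induction_on with
  | _ j ih =>
    rcases Nat.eq_zero_or_pos j with rfl | hj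
    · rwa [g0]
    · by_cases hz : g j = 0
      · simp [hz]
      have h1 : g j * p 0 = shift j (p 0) * h j + q j * h₀ - lowerTerms p h g q j := by
        rw [heq j hj]
        ring
      have h2 : (g j * p 0).natDegree ≤ m + n := by
        rw [h1]
        refine (natDegree_sub_le _ _).trans (max_le ((natDegree_add_le _ _).trans (max_le ?_ ?_)) ?_)
        · refine natDegree_mul_le.trans ?_
          rw [natDegree_shift, hn]
          exact add_le_add hnm (hh j hj)
        · refine natDegree_mul_le.trans ?_
          rw [add_comm]
          exact add_le_add hh₀ (hq j hj)
        · exact natDegree_lowerTerms_le hpn ih hq fun b hb => (hh b hb).trans hnm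
      rw [natDegree_mul hz hp, hn] at h2
      omega

/-- Formal solutions of `M H = K L` converge when `M` is polynomial in `t`. -/
theorem geomBounded_of_formal_solution {p h g q : ℕ → ℂ[X]} {h₀ : ℂ[X]} {n m N : ℕ} (hp : p 0 ≠ 0)
    (hn : (p 0).natDegree = n) (hpn : ∀ k, (p k).natDegree ≤ n)
    (hpb : GeomBounded fun k => polyNorm (p k)) (hnm : n ≤ m)
    (heq : ∀ j, 1 ≤ j → shift j (p 0) * h j + q j * h₀ = g j * p 0 + lowerTerms p h g q j)
    (hh : ∀ j, 1 ≤ j → (h j).degree < (p 0).degree) (hg : ∀ j, (g j).natDegree ≤ m)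
    (hq : ∀ j, 1 ≤ j → (q j).natDegree ≤ n) (hN : ∀ j, N < j → q j = 0) :
    GeomBounded (fun k => polyNorm (h k)) ∧ GeomBounded (fun k => polyNorm (g k)) := by
  set y : ℕ → ℝ := fun j => (1 + (j : ℝ)) ^ n * polyNorm (h j) + polyNorm (g j) with hy
  set w : ℕ → ℝ := fun k => (1 + (k : ℝ)) ^ m * polyNorm (p k) + polyNorm (q k) with hw
  have hh' : ∀ j, 1 ≤ j → (h j).natDegree ≤ n := fun j hj =>
    hn ▸ natDegree_le_natDegree (hh j hj).le
  have hy0 : ∀ j, 0 ≤ y j := fun j =>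
    add_nonneg (mul_nonneg (by positivity) (polyNorm_nonneg _)) (polyNorm_nonneg _)
  have hwb : GeomBounded w := by
    refine ((GeomBounded.one_add_natCast_pow m).mul hpb fun _ => polyNorm_nonneg _).add
      ((GeomBounded.const (∑ k ∈ Finset.range (N + 1), polyNorm (q k))).mono fun k => ?_)
    rcases lt_or_ge N k with hk | hk
    · rw [hN k hk, polyNorm_zero]
      exact Finset.sum_nonneg fun _ _ => polyNorm_nonneg _
    · exact Finset.single_le_sum (f := fun k => polyNorm (q k)) (fun _ _ => polyNorm_nonneg _)
        (Finset.mem_range.2 (Nat.lt_succ_of_le hk))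
  obtain ⟨c, J, hc, hJ, hlow⟩ := exists_pow_mul_polyNorm_le hp
  obtain ⟨c₁, hc₁, hmod⟩ := exists_polyNorm_mod_le (p 0) (m + n)
  obtain ⟨c₂, hc₂, hdiv⟩ := exists_polyNorm_le_mul hp (m + n)
  have hP := polyNorm_nonneg (p 0)
  set P := polyNorm (p 0)
  set E := 2 ^ n * (c * c₁) with hE
  have hE0 : 0 ≤ E := by positivity
  have hyb : GeomBounded y := by
    -- Beyond `N` the term `q_j h_0` vanishes, so modulo `p_0` the equation determines `h_j` from
    -- `lowerTerms`; beyond `J` the lower bound for multiplication by `p_0^{[j]}` holds.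
    refine hwb.of_le_convolution hy0 (C := E + c₂ * (P * E + 1)) (by positivity) (max J (N + 1))
      fun j hj => ?_
    have hjJ : J ≤ j := (le_max_left _ _).trans hj
    have hjN : N < j := (le_max_right _ _).trans hj
    have hj1 : 1 ≤ j := hJ.trans hjJ
    have hj1' : (1 : ℝ) ≤ j := by exact_mod_cast hj1
    have hF := polyNorm_lowerTerms_le (p := p) (h := h) j hg hq
    have hx0 := polyNorm_nonneg (lowerTerms p h g q j)
    have hFd : (lowerTerms p h g q j).natDegree ≤ m + n :=
      natDegree_lowerTerms_le hpn (fun a _ => hg a) hq fun b hb => (hh' b hb).trans hnm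
    have e := heq j hj1
    rw [hN j hjN, zero_mul, add_zero] at e
    have h1 := hlow j hjJ (h j) (hh j hj1)
    rw [e, add_mod, EuclideanDomain.mod_eq_zero.2 (dvd_mul_left _ _), zero_add, hn] at h1
    have h2 := hmod _ hFd
    set x := polyNorm (lowerTerms p h g q j)
    have h3 : (1 + (j : ℝ)) ^ n * polyNorm (h j) ≤ E * x := by
      calc (1 + (j : ℝ)) ^ n * polyNorm (h j) ≤ (2 * (j : ℝ)) ^ n * polyNorm (h j) := by
            refine mul_le_mul_of_nonneg_right (pow_le_pow_left₀ (by positivity) ?_ n)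
              (polyNorm_nonneg _)
            linarith
        _ = 2 ^ n * ((j : ℝ) ^ n * polyNorm (h j)) := by rw [mul_pow, mul_assoc]
        _ ≤ 2 ^ n * (c * (c₁ * x)) := by
            refine mul_le_mul_of_nonneg_left (h1.trans ?_) (by positivity)
            exact mul_le_mul_of_nonneg_left h2 hc
        _ = _ := by rw [hE]; ring
    have e' : g j * p 0 = shift j (p 0) * h j - lowerTerms p h g q j := by
      rw [e]
      ring
    -- Once `h_j` is bounded, `g_j` is recovered from the exact equation by dividing by `p_0`; the
    -- growth of `p_0^{[j]}` is paid for by the weight in `h3`.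
    have h4 : polyNorm (g j) ≤ c₂ * (P * E + 1) * x := by
      have h5 : polyNorm (g j * p 0) ≤ P * (E * x) + x := by
        rw [e']
        refine (polyNorm_sub_le _ _).trans (add_le_add ?_ le_rfl)
        refine (polyNorm_mul_le _ _).trans ?_
        calc _ ≤ (1 + (j : ℝ)) ^ n * P * polyNorm (h j) :=
              mul_le_mul_of_nonneg_right (polyNorm_shift_le (hpn 0) j) (polyNorm_nonneg _)
          _ = P * ((1 + (j : ℝ)) ^ n * polyNorm (h j)) := by ring
          _ ≤ _ := mul_le_mul_of_nonneg_left h3 hP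
      have h6 : (g j * p 0).natDegree ≤ m + n :=
        natDegree_mul_le.trans (add_le_add (hg j) (hpn 0))
      calc _ ≤ c₂ * polyNorm (g j * p 0) := hdiv _ h6
        _ ≤ c₂ * (P * (E * x) + x) := mul_le_mul_of_nonneg_left h5 hc₂
        _ = _ := by ring
    calc y j ≤ E * x + c₂ * (P * E + 1) * x := add_le_add h3 h4
      _ = (E + c₂ * (P * E + 1)) * x := by ring
      _ ≤ _ := mul_le_mul_of_nonneg_left hF (by positivity)
  refine ⟨hyb.mono fun k => ?_, hyb.mono fun k => ?_⟩
  · have h1 : (1 : ℝ) ≤ (1 + (k : ℝ)) ^ n := one_le_pow₀ (by simp)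
    have h2 := le_mul_of_one_le_left (polyNorm_nonneg (h k)) h1
    have h3 := polyNorm_nonneg (g k)
    simp only [hy]
    linarith
  · simp only [hy]
    exact le_add_of_nonneg_left (mul_nonneg (by positivity) (polyNorm_nonneg _))

/-! ### From expansions to operators -/

/-- A sequence of polynomials with bounded degrees and geometrically bounded norms is the
noncommutative Taylor expansion of an operator. -/
theorem exists_diffOp_of_geomBounded {s : ℕ → ℂ[X]} {m : ℕ} (hs : ∀ k, (s k).natDegree ≤ m)
    (hb : GeomBounded fun k => polyNorm (s k)) : ∃ P : DiffOp, ∀ k, taylorPart k P = s k := by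
  have h := fun i => exists_germ_of_geomBounded (a := fun k => (s k).coeff i)
    (hb.mono fun k => norm_coeff_le_polyNorm (s k) i)
  choose φ hφ using h
  refine ⟨∑ i ∈ Finset.range (m + 1), monomial i (φ i), fun k => ?_⟩
  ext i
  rw [coeff_taylorPart, finsetSum_coeff]
  simp only [coeff_monomial, Finset.sum_ite_eq', Finset.mem_range]
  split_ifs with hi
  · exact hφ i k
  · rw [taylorCoeff_zero_right, coeff_eq_zero_of_natDegree_lt]
    exact (hs k).trans_lt (by omega)

theorem geomBounded_polyNorm_taylorPart (P : DiffOp) :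
    GeomBounded fun k => polyNorm (taylorPart k P) := by
  have h := GeomBounded.sum (Finset.range (P.natDegree + 1))
    (a := fun i k => ‖taylorCoeff k (P.coeff i)‖) fun i _ => geomBounded_taylorCoeff _
  refine h.mono fun k => le_of_eq ?_
  rw [polyNorm_eq_sum_range (Nat.lt_succ_of_le (natDegree_taylorPart_le k P))]
  simp only [coeff_taylorPart, Nat.succ_eq_add_one]

/-- The normal form on the level of noncommutative Taylor expansions: `q` is the expansion of `M`,
and `h`, `g` are the convergent expansions of the operators `H`, `K` conjugating it to `p`. -/
theorem exists_convergent_solution {p : ℕ → ℂ[X]} {n : ℕ} (hcn : (p 0).coeff n ≠ 0)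
    (hpn : ∀ k, (p k).natDegree ≤ n) (hpb : GeomBounded fun k => polyNorm (p k)) :
    ∃ (N : ℕ) (q h g : ℕ → ℂ[X]), q 0 = p 0 ∧ h 0 = X * p 0 + 1 ∧ g 0 = X * p 0 + 1 ∧
      (∀ j, 1 ≤ j → (q j).degree < (nu (p 0) j : WithBot ℕ)) ∧
      (∀ j, 1 ≤ j → IsNonresonantOrder (p 0) j → q j = 0) ∧ (∀ j, N < j → q j = 0) ∧
      (∀ j, (q j).natDegree ≤ n) ∧ (∀ j, (h j).natDegree ≤ n + 1) ∧
      (∀ j, (g j).natDegree ≤ n + 1) ∧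
      (GeomBounded fun k => polyNorm (h k)) ∧ (GeomBounded fun k => polyNorm (g k)) ∧
      ∀ j, ∑ y ∈ Finset.HasAntidiagonal.antidiagonal j, shift y.2 (q y.1) * h y.2
        = ∑ y ∈ Finset.HasAntidiagonal.antidiagonal j, shift y.2 (g y.1) * p y.2 := by
  have hn : (p 0).natDegree = n := le_antisymm (hpn 0) (le_natDegree_of_ne_zero hcn)
  have hp : p 0 ≠ 0 := fun h => hcn (by rw [h, coeff_zero])
  -- The factor `X` keeps the degree at `n + 1` even for constant `p_0`; the simpler `p_0 + 1` would
  -- vanish at `p_0 = -1`.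
  have hcop : IsCoprime (X * p 0 + 1) (p 0) := ⟨1, -X, by ring⟩
  have hh₀n : (X * p 0 + 1).natDegree ≤ n + 1 := by
    refine (natDegree_add_le _ _).trans (max_le (natDegree_mul_le.trans ?_) (by simp))
    rw [natDegree_X, hn, add_comm]
  obtain ⟨N, hN⟩ := exists_forall_lt_isNonresonantOrder hp
  obtain ⟨h, g, q, h0, g0, q0, hsol⟩ := exists_formal_solution hp hcop
  have heq := fun j hj => (hsol j hj).1
  have hhd := fun j hj => (hsol j hj).2.1
  have hqd := fun j hj => (hsol j hj).2.2
  have hres : ∀ j, 1 ≤ j → IsNonresonantOrder (p 0) j → q j = 0 := fun j hj hr => by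
    have h1 := hqd j hj
    rw [nu_eq_zero_of_isNonresonantOrder hr] at h1
    by_contra hne
    exact absurd (zero_le_degree_iff.2 hne) (not_le.2 h1)
  have hqN : ∀ j, N < j → q j = 0 := fun j hj => hres j (by omega) (hN j hj)
  have hqn : ∀ j, 1 ≤ j → (q j).natDegree ≤ n := fun j hj => by
    have h1 := (nu_le (p 0) hp j).trans hn.le
    exact natDegree_le_of_degree_le ((hqd j hj).le.trans (by exact_mod_cast h1))
  have hhn : ∀ j, 1 ≤ j → (h j).natDegree ≤ n := fun j hj =>
    (natDegree_le_natDegree (hhd j hj).le).trans hn.le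
  have hgn := natDegree_le_of_formal_solution hp hn hpn n.le_succ hh₀n g0 heq hhn hqn
  obtain ⟨hhb, hgb⟩ := geomBounded_of_formal_solution hp hn hpn hpb n.le_succ heq hhd hgn hqn hqN
  refine ⟨N, q, h, g, q0, h0, g0, hqd, hres, hqN, fun j => ?_, fun j => ?_, hgn, hhb, hgb,
    sum_antidiagonal_eq_of_formal_solution h0 g0 q0 heq⟩
  · rcases Nat.eq_zero_or_pos j with rfl | hj
    · rw [q0]
      exact hpn 0
    · exact hqn j hj
  · rcases Nat.eq_zero_or_pos j with rfl | hj
    · rwa [h0]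
    · exact (hhn j hj).trans n.le_succ

end FuchsianOps

theorem proposition5 (L : FuchsianOps.DiffOp) (hL : FuchsianOps.IsFuchsian L) :
    ∃ (N : ℕ) (q : ℕ → ℂ[X]) (M : FuchsianOps.DiffOp),
      M = FuchsianOps.eulerOp (FuchsianOps.eulerPart L)
          + ∑ j ∈ Finset.Icc 1 N, FuchsianOps.tPowOp j (q j) ∧
      FuchsianOps.IsFuchsian M ∧
      FuchsianOps.FEquiv L M ∧
      (∀ j, 1 ≤ j → (q j).degree < (FuchsianOps.nu (FuchsianOps.eulerPart L) j : WithBot ℕ)) ∧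
      (∀ j, 1 ≤ j → FuchsianOps.IsNonresonantOrder (FuchsianOps.eulerPart L) j → q j = 0) ∧
      (∀ j, N < j → q j = 0) := by
  have hcn := hL.coeff_eulerPart_ne_zero
  -- The top coefficient of `X p_0 + 1` is that of `p_0`; its being nonzero makes `H` and `K`
  -- Fuchsian of order `n + 1`.
  have hh₀c : (X * FuchsianOps.eulerPart L + 1).coeff (L.natDegree + 1) ≠ 0 := by
    rw [coeff_add, coeff_X_mul, coeff_one, if_neg (Nat.succ_ne_zero _), add_zero]
    exact hcn
  obtain ⟨N, q, h, g, q0, h0, g0, hqd, hres, hqN, hqn, hhn, hgn, hhb, hgb, hsum⟩ :=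
    FuchsianOps.exists_convergent_solution (p := fun k => FuchsianOps.taylorPart k L) hcn
      (fun k => FuchsianOps.natDegree_taylorPart_le k L)
      (FuchsianOps.geomBounded_polyNorm_taylorPart L)
  obtain ⟨H, hH⟩ := FuchsianOps.exists_diffOp_of_geomBounded hhn hhb
  obtain ⟨K, hK⟩ := FuchsianOps.exists_diffOp_of_geomBounded hgn hgb
  obtain ⟨M, hM⟩ : ∃ M, M = FuchsianOps.eulerOp (FuchsianOps.eulerPart L)
      + ∑ j ∈ Finset.Icc 1 N, FuchsianOps.tPowOp j (q j) :=
    ⟨_, rfl⟩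
  have hMt : ∀ k, FuchsianOps.taylorPart k M = q k := fun k => by
    rw [hM, FuchsianOps.taylorPart_eulerOp_add_sum]
    split_ifs with h1 h2
    · rw [h1]
      exact q0.symm
    · rfl
    · rw [hqN k (not_le.1 h2)]
  have hMF := FuchsianOps.natDegree_eq_of_taylorPart (P := M) (n := L.natDegree)
    (fun k => by rw [hMt]; exact hqn k) (by rw [hMt, q0]; exact hcn)
  have hHF := FuchsianOps.natDegree_eq_of_taylorPart (P := H) (n := L.natDegree + 1)
    (fun k => by rw [hH]; exact hhn k) (by rw [hH, h0]; exact hh₀c)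
  have hKF := FuchsianOps.natDegree_eq_of_taylorPart (P := K) (n := L.natDegree + 1)
    (fun k => by rw [hK]; exact hgn k) (by rw [hK, g0]; exact hh₀c)
  refine ⟨N, q, M, hM, hMF.2, ⟨hMF.1.symm, H, K, hHF.2, hKF.2, ?_, ?_⟩, hqd, hres, hqN⟩
  · refine FuchsianOps.toOp_mul_toOp_eq_of_taylorPart fun k => ?_
    simp only [hMt, hH, hK]
    exact hsum k
  · rw [FuchsianOps.eulerPart, hH, h0]
    exact ⟨1, -X, by rw [FuchsianOps.eulerPart]; ring⟩
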